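/- Let $\mathbf S$ be the category of simplicial sets, let $\Delta^n$ be the standard $n$-simplex, $\dot\Delta^n\subset\Delta^n$ its boundary, and $\Lambda^p_k\subset\Delta^p$ its $k$-th horn. A simplicial map is a *Kan fibration* if it has the right lifting property with respect to the inclusions $\Lambda^p_k\to\Delta^p$ for all $p>0$, $0\le k\le p$; a simplicial set $Z$ is a *Kan complex* if the map from $Z$ to a terminal object is a Kan fibration. Two simplicial maps $g,g':X\to Z$ are *homotopic* if there is a simplicial map $h:X\times\Delta^1\to Z$ that restricts to $g$ on $X\times\{0\}$ and to $g'$ on $X\times\{1\}$; when $Z$ is a Kan complex this is an equivalence relation, and $[X,Z]$ denotes the set of homotopy classes of maps $X\to Z$. A map $f:X\to Y$ is a *weak equivalence* if for every Kan complex $Z$ the induced map $f^\sharp:[Y,Z]\to[X,Z]$, $[g]\mapsto[g\circ f]$, is a bijection, and an *acyclic fibration* if it is both a Kan fibration and a weak equivalence. **Lemma.** A map $f:X\to Y$ of simplicial sets is an acyclic fibration if and only if it has the right lifting property with respect to the boundary inclusions $\dot\Delta^n\to\Delta^n$ for all $n\ge 0$. -/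

import Mathlib

open CategoryTheory MonoidalCategory
open scoped Simplicial SSet.modelCategoryQuillen

universe u

namespace SimplicialHomotopy

/-- Two simplicial maps `f g : X ⟶ Z` are homotopic if there is a simplicial map
`h : X ⊗ Δ[1] ⟶ Z` whose restrictions to the two ends of the cylinder are `f` and `g`. -/
def Homotopic {X Z : SSet.{u}} (f g : X ⟶ Z) : Prop :=
  Nonempty (SSet.Homotopy f g)

/-- The definition of homotopic maps, spelled out. -/
theorem homotopic_iff {X Z : SSet.{u}} (f g : X ⟶ Z) :
    Homotopic f g ↔ ∃ h : X ⊗ Δ[1] ⟶ Z, SSet.ι₀ ≫ h = f ∧ SSet.ι₁ ≫ h = g := by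
  constructor
  · rintro ⟨H⟩
    exact ⟨H.h, H.h₀, H.h₁⟩
  · rintro ⟨h, h₀, h₁⟩
    refine ⟨{ h := h, h₀ := h₀, h₁ := h₁, rel := ?_ }⟩
    ext m ⟨⟨_, hx⟩, _⟩
    exact hx.elim

/-- Precomposition preserves the homotopy relation. -/
theorem Homotopic.precomp {X Y Z : SSet.{u}} (f : X ⟶ Y) {g g' : Y ⟶ Z}
    (H : Homotopic g g') : Homotopic (f ≫ g) (f ≫ g') := by
  rw [homotopic_iff] at H ⊢
  obtain ⟨h, rfl, rfl⟩ := H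
  exact ⟨f ▷ Δ[1] ≫ h, by simp, by simp⟩

/-- The homotopy set `[X, Z]`: the quotient of the set of simplicial maps `X ⟶ Z` by the
homotopy relation. It is used only when `Z` is a Kan complex, in which case the homotopy
relation is an equivalence relation. (In general, `Quot` is the quotient by the equivalence
relation generated by it.) -/
def HomotopySet (X Z : SSet.{u}) : Type u :=
  Quot (Homotopic (X := X) (Z := Z))

/-- The map `f^♯ : [Y, Z] ⟶ [X, Z]`, `[g] ↦ [f ≫ g]`, induced by `f : X ⟶ Y`. -/
def HomotopySet.precomp {X Y : SSet.{u}} (f : X ⟶ Y) (Z : SSet.{u}) :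
    HomotopySet Y Z → HomotopySet X Z :=
  Quot.map (fun g => f ≫ g) (fun _ _ H => H.precomp f)

/-- A map of simplicial sets `f : X ⟶ Y` is a weak equivalence if it induces a bijection
`f^♯ : [Y, Z] ⟶ [X, Z]` for every Kan complex `Z`. -/
def IsWeakEquivalence {X Y : SSet.{u}} (f : X ⟶ Y) : Prop :=
  ∀ Z : SSet.{u}, SSet.KanComplex Z → Function.Bijective (HomotopySet.precomp f Z)

/-- An acyclic fibration is a Kan fibration that is also a weak equivalence. In the scope
`SSet.modelCategoryQuillen`, the class `Fibration` is that of the maps with the right lifting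
property with respect to the horn inclusions `Λ[p, k] ⟶ Δ[p]`, where `0 < p` and `0 ≤ k ≤ p`. -/
def IsAcyclicFibration {X Y : SSet.{u}} (f : X ⟶ Y) : Prop :=
  HomotopicalAlgebra.Fibration f ∧ IsWeakEquivalence f

end SimplicialHomotopy

/-!
Let `I` be the set of boundary inclusions `∂Δ[n] ⟶ Δ[n]`. As `I` generates all monomorphisms, a
map `f : X ⟶ Y` in `I.rlp` is a Kan fibration, has a section `s`, and any two lifts of a map along
it are homotopic over the base (`exists_homotopy_of_rlp`). Hence `s` is a homotopy inverse of `f`,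
and `f` is a weak equivalence (`isWeakEquivalence_of_rlp`).

Conversely let `f` be a Kan fibration and a weak equivalence. Factor `f = j ≫ r` with `j` a
monomorphism and `r` in `I.rlp`. By the first part and two-out-of-three `j` is a weak equivalence.
If `j` lifts against `f`, then `f` is a retract of `r`, so that it belongs to `I.rlp`. Two facts
provide the lift.

* An acyclic monomorphism `j : A ⟶ B` lifts against Kan fibrations between Kan complexes
  (`hasLiftingProperty_of_isWeakEquivalence`). For a Kan complex `Z`, the fibration
  `Z ^ B ⟶ Z ^ A` is a homotopy equivalence by the exponential law, because the definition of a
  weak equivalence can be applied to the Kan complexes `Z ^ K`. A Kan fibration between Kan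
  complexes which is a homotopy equivalence belongs to `I.rlp` (`rlp_of_homotopyInverse`). So a map
  `A ⟶ Z` extends to `B`, uniquely up to homotopy relative to `A`, and such a homotopy in the base
  is lifted by the homotopy lifting extension property.

* Every Kan fibration `f : X ⟶ Y` is the pullback of a Kan fibration between Kan complexes
  (`exists_isPullback_kanComplex`), against which `j` lifts. To construct it, all horns of `Y` are
  filled at once, by a pushout of `Y` along a coproduct of horn inclusions, and `f` is extended over
  the result; after countably many steps the base is a Kan complex. A horn is contractible, so
  extending `f` over a new simplex reduces, by `extends_iff_of_homotopy`, to extending the pullback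
  of `f` along a map `Λ[n, k] ⟶ Y` which factors through `Δ[n]`. This invariance under homotopies
  holds because homotopic maps `c₀ c₁ : A ⟶ Y` have pullbacks of `f` dominated by the simplicial
  set of lifts of the paths of the homotopy, through maps in `I.rlp` over `A` (`exists_rlp_span`),
  and because extendability of fibrations passes along such maps in both directions
  (`Extends.of_rlp_comp`, `Extends.rlp_comp`). The latter rests on
  `exists_extension_of_deformationRetract`: over `A ⊆ B`, a fibrewise strong deformation retract of
  the restriction of a Kan fibration `E ⟶ B` is the restriction of a retract of `E` over `B`.
-/

namespace SimplicialHomotopy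

open SSet Limits HomotopicalAlgebra SSet.modelCategoryQuillen
open CartesianMonoidalCategory (fst snd)

/-! ### Homotopy lifting -/

/-- The end `X × {e}` of the cylinder `X × Δ[1]`. For `e = 0` and `e = 1` this is
definitionally `SSet.ι₀` and `SSet.ι₁`. -/
noncomputable def cylinderEnd (e : Fin 2) (X : SSet.{u}) : X ⟶ X ⊗ Δ[1] :=
  CartesianMonoidalCategory.lift (𝟙 X) (const (stdSimplex.obj₀Equiv.{u}.symm e))

lemma cylinderEnd_naturality_assoc (e : Fin 2) {X Y Z : SSet.{u}} (f : X ⟶ Y)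
    (g : Y ⊗ Δ[1] ⟶ Z) :
    cylinderEnd e X ≫ f ▷ Δ[1] ≫ g = f ≫ cylinderEnd e Y ≫ g := rfl

@[simp]
lemma cylinderEnd_fst_assoc (e : Fin 2) {X Z : SSet.{u}} (g : X ⟶ Z) :
    cylinderEnd e X ≫ fst X Δ[1] ≫ g = g := rfl

/-- The simplices of the horn `Λ[1, e]` are degeneracies of the vertex `e`. -/
lemma const_app_eq {e : Fin 2} {X : SSet.{u}} {m : SimplexCategoryᵒᵖ} (x : X.obj m)
    (t : (Λ[1, e] : SSet.{u}).obj m) :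
    (const (X := X) (stdSimplex.obj₀Equiv.{u}.symm e)).app m x = t.1 := by
  obtain ⟨t, ht⟩ := t
  induction m using Opposite.rec with | _ m
  induction m using SimplexCategory.rec with | _ m
  rw [mem_horn_iff_notMem_range] at ht
  obtain ⟨j, hj, ht⟩ := ht
  apply SSet.stdSimplex.ext
  intro i
  have h1 : t i ≠ j := fun h => ht ⟨i, h⟩
  have h2 : e = t i := by
    generalize t i = s at h1
    clear ht
    fin_cases e <;> fin_cases j <;> fin_cases s <;> simp_all
  exact h2

/-- The subobject `X × Λ[1, e]` of the cylinder is its end `X × {e}`. -/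
lemma fst_cylinderEnd (e : Fin 2) (X : SSet.{u}) :
    fst X (Λ[1, e] : SSet.{u}) ≫ cylinderEnd e X = X ◁ (Λ[1, e] : Δ[1].Subcomplex).ι := by
  ext m ⟨x, t⟩
  · rfl
  · exact const_app_eq x t

/-- Homotopy lifting extension: a homotopy in the base of a Kan fibration lifts, with prescribed
restrictions to one end of the cylinder and to the cylinder over a subcomplex. -/
theorem exists_homotopy_lift (e : Fin 2) {K L X Y : SSet.{u}} (k : K ⟶ L) [Mono k] (f : X ⟶ Y)
    [Fibration f] (a : L ⟶ X) (G : K ⊗ Δ[1] ⟶ X) (H : L ⊗ Δ[1] ⟶ Y)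
    (hG : cylinderEnd e K ≫ G = k ≫ a) (hH : cylinderEnd e L ≫ H = a ≫ f)
    (hGH : k ▷ Δ[1] ≫ H = G ≫ f) :
    ∃ F : L ⊗ Δ[1] ⟶ X, cylinderEnd e L ≫ F = a ∧ k ▷ Δ[1] ≫ F = G ∧ F ≫ f = H := by
  let sq := Functor.PushoutObjObj.ofHasPushout (curriedTensor SSet.{u}) k Λ[1, e].ι
  have hsq := anodyneExtensions_pushoutObjObjι sq (anodyneExtensions.horn_ι e)
  have : HasLiftingProperty sq.ι f := hsq _ ((modelCategoryQuillen.fibration_iff f).1 inferInstance)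
  have w : ((curriedTensor SSet.{u}).map k).app _ ≫ fst L _ ≫ a =
      ((curriedTensor SSet.{u}).obj K).map Λ[1, e].ι ≫ G := by
    change fst K _ ≫ k ≫ a = K ◁ Λ[1, e].ι ≫ G
    rw [← hG, ← fst_cylinderEnd, Category.assoc]
  have w' : sq.isPushout.desc (fst L _ ≫ a) G w ≫ f = sq.ι ≫ H := by
    apply sq.isPushout.hom_ext
    · rw [sq.isPushout.inl_desc_assoc, sq.inl_ι_assoc]
      change (fst L _ ≫ a) ≫ f = L ◁ Λ[1, e].ι ≫ H
      rw [Category.assoc, ← hH, ← fst_cylinderEnd, Category.assoc]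
    · rw [sq.isPushout.inr_desc_assoc, sq.inr_ι_assoc]
      exact hGH.symm
  have cs : CommSq (sq.isPushout.desc (fst L _ ≫ a) G w) sq.ι f H := ⟨w'⟩
  refine ⟨cs.lift, ?_, ?_, cs.fac_right⟩
  · -- `lift` is prescribed on `L × Λ[1, e]`, which contains the end `L × {e}`
    have h1 : L ◁ Λ[1, e].ι ≫ cs.lift = fst L _ ≫ a := by
      have := sq.inl ≫= cs.fac_left
      rwa [sq.inl_ι_assoc, sq.isPushout.inl_desc] at this
    ext m x
    have ht : (const (X := L) (stdSimplex.obj₀Equiv.{u}.symm e)).app m x ∈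
        (Λ[1, e] : Δ[1].Subcomplex).obj m := by
      induction m using Opposite.rec with | _ m
      induction m using SimplexCategory.rec with | _ m
      rw [mem_horn_iff_notMem_range]
      refine ⟨1 - e, by fin_cases e <;> simp, ?_⟩
      rintro ⟨i, hi⟩
      have : e = 1 - e := hi
      fin_cases e <;> simp at this
    exact congr_arg (fun φ => φ.app m ⟨x, ⟨_, ht⟩⟩) h1
  · have := sq.inr ≫= cs.fac_left
    rwa [sq.inr_ι_assoc, sq.isPushout.inr_desc] at this

/-- Homotopy lifting for a Kan fibration, with a prescribed end. -/
theorem exists_homotopy_lift_end (e : Fin 2) {L X Y : SSet.{u}} (f : X ⟶ Y)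
    [Fibration f] (a : L ⟶ X) (H : L ⊗ Δ[1] ⟶ Y) (hH : cylinderEnd e L ≫ H = a ≫ f) :
    ∃ F : L ⊗ Δ[1] ⟶ X, cylinderEnd e L ≫ F = a ∧ F ≫ f = H := by
  have hi : IsInitial ((⊥_ SSet.{u}) ⊗ (Δ[1] : SSet.{u})) :=
    IsInitial.isInitialObj (tensorRight (Δ[1] : SSet.{u})) _ initialIsInitial
  obtain ⟨F, h₁, -, h₂⟩ := exists_homotopy_lift e (initial.to L) f a (hi.to X) H
    (initialIsInitial.hom_ext _ _) hH (hi.hom_ext _ _)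
  exact ⟨F, h₁, h₂⟩

/-! ### Maps with the right lifting property against boundary inclusions -/

lemma hasLiftingProperty_of_rlp {A B X Y : SSet.{u}} (i : A ⟶ B) [Mono i] {f : X ⟶ Y}
    (hf : I.rlp f) : HasLiftingProperty i f := by
  rw [← rlp_monomorphisms] at hf
  exact hf i inferInstance

/-- Horn inclusions are monomorphisms. -/
lemma fibration_of_rlp {X Y : SSet.{u}} {f : X ⟶ Y} (hf : I.rlp f) : Fibration f := by
  rw [modelCategoryQuillen.fibration_iff]
  rw [← rlp_monomorphisms] at hf
  exact fun _ _ i hi => hf i (J_le_monomorphisms _ hi)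

lemma exists_section_of_rlp {X Y : SSet.{u}} {f : X ⟶ Y} (hf : I.rlp f) :
    ∃ s : Y ⟶ X, s ≫ f = 𝟙 Y := by
  have := hasLiftingProperty_of_rlp (initial.to Y) hf
  have sq : CommSq (initial.to X) (initial.to Y) f (𝟙 Y) := ⟨initialIsInitial.hom_ext _ _⟩
  exact ⟨sq.lift, sq.fac_right⟩

open Classical in
/-- Two lifts `a b : Q ⟶ X` of the same map along a map `f` with the right lifting property
against boundary inclusions are homotopic over the base, relative to any subobject on which
they agree. -/
theorem exists_homotopy_of_rlp {P Q X Y : SSet.{u}} (m : P ⟶ Q) [Mono m] {f : X ⟶ Y}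
    (hf : I.rlp f) (a b : Q ⟶ X) (hab : a ≫ f = b ≫ f) (hm : m ≫ a = m ≫ b) :
    ∃ F : Q ⊗ Δ[1] ⟶ X, ι₀ ≫ F = a ∧ ι₁ ≫ F = b ∧ F ≫ f = fst _ _ ≫ a ≫ f ∧
      m ▷ Δ[1] ≫ F = fst _ _ ≫ m ≫ a := by
  let c (e : Fin 2) : Q ⟶ Δ[1] := const (stdSimplex.obj₀Equiv.{u}.symm e)
  have hc (e : Fin 2) {j k : SimplexCategoryᵒᵖ} (φ : j ⟶ k) (q q' : Q.obj j) :
      Δ[1].map φ ((c e).app j q) = (c e).app k (Q.map φ q') := rfl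
  have hc01 {j : SimplexCategoryᵒᵖ} (q q' : Q.obj j) : (c 0).app j q ≠ (c 1).app j q' := by
    intro h
    induction j using Opposite.rec with | _ j
    induction j using SimplexCategory.rec with | _ j
    have : (0 : Fin 2) = 1 := congr_arg (fun t : Δ[1] _⦋j⦌ => t 0) h
    simp at this
  -- the homotopy is prescribed on the subcomplex `Q × {0} ∪ Q × {1} ∪ P × Δ[1]` of the cylinder
  let S : (Q ⊗ Δ[1]).Subcomplex :=
    { obj j := Set.ofPred fun z => z.2 = (c 0).app j z.1 ∨ z.2 = (c 1).app j z.1 ∨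
        z.1 ∈ (Subcomplex.range m).obj j
      map := by
        rintro j k φ z (h | h | h)
        · exact Or.inl ((congr_arg (Δ[1].map φ) h).trans (hc 0 φ _ _))
        · exact Or.inr (Or.inl ((congr_arg (Δ[1].map φ) h).trans (hc 1 φ _ _)))
        · exact Or.inr (Or.inr ((Subcomplex.range m).map φ h)) }
  have key {j : SimplexCategoryᵒᵖ} (z : (Q ⊗ Δ[1]).obj j)
      (hz : z.1 ∈ (Subcomplex.range m).obj j) : a.app j z.1 = b.app j z.1 := by
    obtain ⟨p, hp⟩ := hz
    rw [← hp]
    exact congr_arg (fun φ => φ.app j p) hm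
  let g : (S : SSet.{u}) ⟶ X :=
    { app j := ↾fun z => if z.1.2 = (c 1).app j z.1.1 then b.app j z.1.1 else a.app j z.1.1
      naturality := by
        intro j k φ
        ext ⟨z, hz⟩
        change (if Δ[1].map φ z.2 = (c 1).app k (Q.map φ z.1) then b.app k (Q.map φ z.1)
          else a.app k (Q.map φ z.1)) = X.map φ (if z.2 = (c 1).app j z.1 then b.app j z.1
          else a.app j z.1)
        by_cases h : z.2 = (c 1).app j z.1
        · rw [if_pos h, if_pos (by rw [h]; exact hc 1 φ _ _)]
          exact NatTrans.naturality_apply b φ z.1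
        · rw [if_neg h]
          by_cases h' : Δ[1].map φ z.2 = (c 1).app k (Q.map φ z.1)
          · rw [if_pos h']
            have hz' : z.1 ∈ (Subcomplex.range m).obj j := by
              rcases hz with hz | hz | hz
              · rw [hz, hc 0 φ z.1 z.1] at h'
                exact (hc01 _ _ h').elim
              · exact (h hz).elim
              · exact hz
            rw [key z hz']
            exact NatTrans.naturality_apply b φ z.1
          · rw [if_neg h']
            exact NatTrans.naturality_apply a φ z.1 }
  have hab' {j : SimplexCategoryᵒᵖ} (q : Q.obj j) :
      f.app j (a.app j q) = f.app j (b.app j q) := congr_arg (fun φ => φ.app j q) hab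
  have sq : CommSq g S.ι f (fst _ _ ≫ a ≫ f) := ⟨by
    ext j ⟨z, hz⟩
    change f.app j (if z.2 = (c 1).app j z.1 then b.app j z.1 else a.app j z.1) =
      f.app j (a.app j z.1)
    split_ifs
    · exact (hab' _).symm
    · rfl⟩
  have := hasLiftingProperty_of_rlp S.ι hf
  have hlift {j : SimplexCategoryᵒᵖ} (z : (Q ⊗ Δ[1]).obj j) (hz : z ∈ S.obj j) :
      sq.lift.app j z = if z.2 = (c 1).app j z.1 then b.app j z.1 else a.app j z.1 :=
    congr_arg (fun φ => φ.app j ⟨z, hz⟩) sq.fac_left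
  refine ⟨sq.lift, ?_, ?_, sq.fac_right, ?_⟩
  · ext j q
    exact (hlift (ι₀.app j q) (Or.inl rfl)).trans (if_neg (hc01 q q))
  · ext j q
    exact (hlift (ι₁.app j q) (Or.inr (Or.inl rfl))).trans (if_pos rfl)
  · ext j ⟨p, t⟩
    have hz : (show (Q ⊗ Δ[1]).obj j from (m.app j p, t)) ∈ S.obj j := Or.inr (Or.inr ⟨p, rfl⟩)
    refine (hlift _ hz).trans ?_
    change (if _ then b.app j (m.app j p) else a.app j (m.app j p)) = a.app j (m.app j p)
    split_ifs
    · exact (key (m.app j p, t) ⟨p, rfl⟩).symm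
    · rfl

/-! ### Maps with the right lifting property are acyclic fibrations -/

lemma Homotopic.postcomp {X Y Z : SSet.{u}} {g g' : X ⟶ Y} (H : Homotopic g g') (f : Y ⟶ Z) :
    Homotopic (g ≫ f) (g' ≫ f) := by
  rw [homotopic_iff] at H ⊢
  obtain ⟨h, rfl, rfl⟩ := H
  exact ⟨h ≫ f, rfl, rfl⟩

lemma isWeakEquivalence_of_homotopyInverse {X Y : SSet.{u}} (f : X ⟶ Y) (s : Y ⟶ X)
    (hs : Homotopic (s ≫ f) (𝟙 Y)) (hf : Homotopic (f ≫ s) (𝟙 X)) : IsWeakEquivalence f := by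
  intro Z _
  refine Function.bijective_iff_has_inverse.2 ⟨HomotopySet.precomp s Z, ?_, ?_⟩
  · rintro ⟨g⟩
    exact Quot.sound (by simpa using hs.postcomp g)
  · rintro ⟨g⟩
    exact Quot.sound (by simpa using hf.postcomp g)

lemma isWeakEquivalence_of_rlp {X Y : SSet.{u}} {f : X ⟶ Y} (hf : I.rlp f) :
    IsWeakEquivalence f := by
  obtain ⟨s, hs⟩ := exists_section_of_rlp hf
  obtain ⟨F, h₀, h₁, -, -⟩ := exists_homotopy_of_rlp (initial.to X) hf (f ≫ s) (𝟙 X)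
    (by simp [hs]) (initialIsInitial.hom_ext _ _)
  refine isWeakEquivalence_of_homotopyInverse f s ?_ ((homotopic_iff _ _).2 ⟨F, h₀, h₁⟩)
  rw [hs, homotopic_iff]
  exact ⟨fst _ _, rfl, rfl⟩

/-- One case of the two-out-of-three property of weak equivalences. -/
lemma IsWeakEquivalence.of_comp {X Y Z : SSet.{u}} {f : X ⟶ Y} {g : Y ⟶ Z}
    (hg : IsWeakEquivalence g) (hfg : IsWeakEquivalence (f ≫ g)) : IsWeakEquivalence f := by
  intro T hT
  have h : HomotopySet.precomp (f ≫ g) T = HomotopySet.precomp f T ∘ HomotopySet.precomp g T := by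
    ext ⟨x⟩
    exact congr_arg (Quot.mk _) (Category.assoc _ _ _)
  have := hfg T hT
  rw [h] at this
  exact (Function.Bijective.of_comp_iff _ (hg T hT)).1 this

/-! ### Homotopy of maps into a Kan complex -/

open Classical in
/-- Lifting of a square of homotopies along a Kan fibration, when the lifts of three of its sides
are given: `G₀` and `G₁` over the two ends of the first cylinder, and `a` at the end `e` of the
second one. -/
theorem exists_square_lift (e : Fin 2) {X E D : SSet.{u}} (f : E ⟶ D) [Fibration f]
    (a G₀ G₁ : X ⊗ Δ[1] ⟶ E) (H : (X ⊗ Δ[1]) ⊗ Δ[1] ⟶ D)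
    (h₀ : cylinderEnd e X ≫ G₀ = ι₀ ≫ a) (h₁ : cylinderEnd e X ≫ G₁ = ι₁ ≫ a)
    (hH : cylinderEnd e _ ≫ H = a ≫ f)
    (hH₀ : ι₀ ▷ Δ[1] ≫ H = G₀ ≫ f) (hH₁ : ι₁ ▷ Δ[1] ≫ H = G₁ ≫ f) :
    ∃ F : (X ⊗ Δ[1]) ⊗ Δ[1] ⟶ E, cylinderEnd e _ ≫ F = a ∧ ι₀ ▷ Δ[1] ≫ F = G₀ ∧
      ι₁ ▷ Δ[1] ≫ F = G₁ ∧ F ≫ f = H := by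
  let c (e : Fin 2) : X ⟶ Δ[1] := const (stdSimplex.obj₀Equiv.{u}.symm e)
  have hc (e : Fin 2) {j k : SimplexCategoryᵒᵖ} (φ : j ⟶ k) (q q' : X.obj j) :
      Δ[1].map φ ((c e).app j q) = (c e).app k (X.map φ q') := rfl
  have hc01 {j : SimplexCategoryᵒᵖ} (q q' : X.obj j) : (c 0).app j q ≠ (c 1).app j q' := by
    intro h
    induction j using Opposite.rec with | _ j
    induction j using SimplexCategory.rec with | _ j
    have : (0 : Fin 2) = 1 := congr_arg (fun t : Δ[1] _⦋j⦌ => t 0) h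
    simp at this
  -- the two ends `X × {0} ∪ X × {1}` of the cylinder
  let S : (X ⊗ Δ[1]).Subcomplex :=
    { obj j := Set.ofPred fun z => z.2 = (c 0).app j z.1 ∨ z.2 = (c 1).app j z.1
      map := by
        rintro j k φ z (h | h)
        · exact Or.inl ((congr_arg (Δ[1].map φ) h).trans (hc 0 φ _ _))
        · exact Or.inr ((congr_arg (Δ[1].map φ) h).trans (hc 1 φ _ _)) }
  let G : (S : SSet.{u}) ⊗ Δ[1] ⟶ E :=
    { app j := ↾fun z => if z.1.1.2 = (c 1).app j z.1.1.1 then G₁.app j (z.1.1.1, z.2)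
        else G₀.app j (z.1.1.1, z.2)
      naturality := by
        intro j k φ
        ext ⟨⟨z, hz⟩, t⟩
        change (if Δ[1].map φ z.2 = (c 1).app k (X.map φ z.1) then
          G₁.app k (X.map φ z.1, Δ[1].map φ t) else G₀.app k (X.map φ z.1, Δ[1].map φ t)) =
          E.map φ (if z.2 = (c 1).app j z.1 then G₁.app j (z.1, t) else G₀.app j (z.1, t))
        rcases hz with hz | hz
        · rw [if_neg (by rw [hz, hc 0 φ z.1 z.1]; exact hc01 _ _),
            if_neg (by rw [hz]; exact hc01 _ _)]
          exact NatTrans.naturality_apply G₀ φ (show (X ⊗ Δ[1]).obj j from (z.1, t))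
        · rw [if_pos hz, if_pos (by rw [hz]; exact hc 1 φ _ _)]
          exact NatTrans.naturality_apply G₁ φ (show (X ⊗ Δ[1]).obj j from (z.1, t)) }
  have hG₀ {j : SimplexCategoryᵒᵖ} (z : S.obj j) (t : Δ[1].obj j)
      (hz : z.1.2 = (c 0).app j z.1.1) : G.app j (z, t) = G₀.app j (z.1.1, t) :=
    if_neg (by rw [hz]; exact hc01 _ _)
  have hG₁ {j : SimplexCategoryᵒᵖ} (z : S.obj j) (t : Δ[1].obj j)
      (hz : z.1.2 = (c 1).app j z.1.1) : G.app j (z, t) = G₁.app j (z.1.1, t) :=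
    if_pos hz
  have w₁ : cylinderEnd e (S : SSet.{u}) ≫ G = S.ι ≫ a := by
    ext j ⟨⟨x, t⟩, hz⟩
    rcases hz with hz | hz
    · obtain rfl : t = (c 0).app j x := hz
      exact (hG₀ _ _ rfl).trans (congr_arg (fun φ => φ.app j x) h₀)
    · obtain rfl : t = (c 1).app j x := hz
      exact (hG₁ _ _ rfl).trans (congr_arg (fun φ => φ.app j x) h₁)
  have w₂ : S.ι ▷ Δ[1] ≫ H = G ≫ f := by
    ext j ⟨⟨⟨x, t⟩, hz⟩, s⟩
    rcases hz with hz | hz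
    · obtain rfl : t = (c 0).app j x := hz
      exact (congr_arg (fun φ => φ.app j (x, s)) hH₀).trans
        (congr_arg (f.app j) (hG₀ ⟨(x, _), Or.inl rfl⟩ s rfl).symm)
    · obtain rfl : t = (c 1).app j x := hz
      exact (congr_arg (fun φ => φ.app j (x, s)) hH₁).trans
        (congr_arg (f.app j) (hG₁ ⟨(x, _), Or.inr rfl⟩ s rfl).symm)
  obtain ⟨F, hF₁, hF₂, hF₃⟩ := exists_homotopy_lift e S.ι f a G H w₁ hH w₂
  refine ⟨F, hF₁, ?_, ?_, hF₃⟩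
  · ext j ⟨x, s⟩
    exact (congr_arg (fun φ => φ.app j (⟨(x, _), Or.inl rfl⟩, s)) hF₂).trans
      (hG₀ ⟨(x, _), Or.inl rfl⟩ s rfl)
  · ext j ⟨x, s⟩
    exact (congr_arg (fun φ => φ.app j (⟨(x, _), Or.inr rfl⟩, s)) hF₂).trans
      (hG₁ ⟨(x, _), Or.inr rfl⟩ s rfl)

lemma Homotopic.refl {X Z : SSet.{u}} (f : X ⟶ Z) : Homotopic f f :=
  (homotopic_iff _ _).2 ⟨fst _ _ ≫ f, rfl, rfl⟩

/-- In a Kan complex, the fourth side of a square of homotopies can be filled. -/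
lemma homotopic_of_square {X Z : SSet.{u}} [KanComplex Z] {a b a' b' : X ⟶ Z}
    (h : Homotopic a b) (ha : Homotopic a a') (hb : Homotopic b b') : Homotopic a' b' := by
  rw [homotopic_iff] at h ha hb ⊢
  obtain ⟨h, rfl, rfl⟩ := h
  obtain ⟨G₀, ha, rfl⟩ := ha
  obtain ⟨G₁, hb, rfl⟩ := hb
  obtain ⟨F, -, hF₀, hF₁, -⟩ := exists_square_lift 0 (terminal.from Z) h G₀ G₁ (terminal.from _)
    ha hb (terminal.hom_ext _ _) (terminal.hom_ext _ _) (terminal.hom_ext _ _)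
  exact ⟨ι₁ ≫ F, by rw [← hF₀, ι₁_comp_assoc], by rw [← hF₁, ι₁_comp_assoc]⟩

lemma Homotopic.symm {X Z : SSet.{u}} [KanComplex Z] {a b : X ⟶ Z} (h : Homotopic a b) :
    Homotopic b a :=
  homotopic_of_square (.refl a) h (.refl a)

lemma Homotopic.trans {X Z : SSet.{u}} [KanComplex Z] {a b c : X ⟶ Z} (h : Homotopic a b)
    (h' : Homotopic b c) : Homotopic a c :=
  homotopic_of_square h (.refl a) h'

/-- The homotopy relation for maps to a Kan complex is an equivalence relation, so that it agrees
with equality of classes in `HomotopySet`. -/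
lemma homotopic_of_mk_eq {X Z : SSet.{u}} [KanComplex Z] {a b : X ⟶ Z}
    (h : (Quot.mk _ a : HomotopySet X Z) = Quot.mk _ b) : Homotopic a b :=
  (Equivalence.eqvGen_iff ⟨.refl, .symm, .trans⟩).1 (Quot.eqvGen_exact h)

/-! ### Kan fibrations that are homotopy equivalences -/

/-- A Kan fibration which has a section and a deformation onto that section over the base has
the right lifting property with respect to boundary inclusions. -/
theorem rlp_of_fiberwise_contraction {E D : SSet.{u}} (p : E ⟶ D) [Fibration p] (s : D ⟶ E)
    (hs : s ≫ p = 𝟙 D) (K : E ⊗ Δ[1] ⟶ E) (hK₀ : ι₀ ≫ K = 𝟙 E) (hK₁ : ι₁ ≫ K = p ≫ s)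
    (hK : K ≫ p = fst _ _ ≫ p) : I.rlp p := by
  rw [← rlp_monomorphisms]
  intro A B i (hi : Mono i)
  refine ⟨fun {u v} sq => ?_⟩
  obtain ⟨F, hF₁, hF₂, hF₃⟩ := exists_homotopy_lift 1 i p (v ≫ s) (u ▷ _ ≫ K) (fst _ _ ≫ v)
    (by
      change ι₁ ≫ _ = _
      rw [ι₁_comp_assoc, hK₁, sq.w_assoc])
    (by simp [hs])
    (by rw [Category.assoc, hK, CartesianMonoidalCategory.whiskerRight_fst_assoc,
      CartesianMonoidalCategory.whiskerRight_fst_assoc, sq.w])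
  refine ⟨⟨ι₀ ≫ F, ?_, ?_⟩⟩
  · have : i ≫ ι₀ ≫ F = ι₀ ≫ i ▷ _ ≫ F := rfl
    rw [this, hF₂]
    change u ≫ ι₀ ≫ K = u
    rw [hK₀, Category.comp_id]
  · rw [Category.assoc, hF₃, ι₀_fst_assoc]

/-- The map `max : Δ[1] × Δ[1] ⟶ Δ[1]`. -/
noncomputable def maxOne : (Δ[1] : SSet.{u}) ⊗ Δ[1] ⟶ Δ[1] where
  app m := ↾fun z => stdSimplex.objMk
    (stdSimplex.asOrderHom z.1 ⊔ stdSimplex.asOrderHom z.2)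

lemma maxOne_app_const_zero_left {X : SSet.{u}} {m : SimplexCategoryᵒᵖ} (x : X.obj m)
    (s : (Δ[1] : SSet.{u}).obj m) :
    maxOne.app m ((const (X := X) (stdSimplex.obj₀Equiv.{u}.symm 0)).app m x, s) = s := by
  induction m using Opposite.rec with | _ m
  induction m using SimplexCategory.rec with | _ m
  refine SSet.stdSimplex.ext _ _ fun i => ?_
  exact max_eq_right (Fin.zero_le (s i))

lemma maxOne_app_const_zero_right {X : SSet.{u}} {m : SimplexCategoryᵒᵖ} (x : X.obj m)
    (s : (Δ[1] : SSet.{u}).obj m) :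
    maxOne.app m (s, (const (X := X) (stdSimplex.obj₀Equiv.{u}.symm 0)).app m x) = s := by
  induction m using Opposite.rec with | _ m
  induction m using SimplexCategory.rec with | _ m
  refine SSet.stdSimplex.ext _ _ fun i => ?_
  exact max_eq_left (Fin.zero_le (s i))

lemma maxOne_app_const_one_left {X : SSet.{u}} {m : SimplexCategoryᵒᵖ} (x : X.obj m)
    (s : (Δ[1] : SSet.{u}).obj m) :
    maxOne.app m ((const (X := X) (stdSimplex.obj₀Equiv.{u}.symm 1)).app m x, s) =
      (const (X := X) (stdSimplex.obj₀Equiv.{u}.symm 1)).app m x := by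
  induction m using Opposite.rec with | _ m
  induction m using SimplexCategory.rec with | _ m
  refine SSet.stdSimplex.ext _ _ fun i => ?_
  exact max_eq_left (Fin.le_last (s i))

lemma maxOne_app_const_one_right {X : SSet.{u}} {m : SimplexCategoryᵒᵖ} (x : X.obj m)
    (s : (Δ[1] : SSet.{u}).obj m) :
    maxOne.app m (s, (const (X := X) (stdSimplex.obj₀Equiv.{u}.symm 1)).app m x) =
      (const (X := X) (stdSimplex.obj₀Equiv.{u}.symm 1)).app m x := by
  induction m using Opposite.rec with | _ m
  induction m using SimplexCategory.rec with | _ m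
  refine SSet.stdSimplex.ext _ _ fun i => ?_
  exact max_eq_right (Fin.le_last (s i))

/-- A Kan fibration between Kan complexes that is a homotopy equivalence has the right lifting
property with respect to boundary inclusions. -/
theorem rlp_of_homotopyInverse {E D : SSet.{u}} [KanComplex E] (p : E ⟶ D) [Fibration p]
    (s : D ⟶ E) (hs : Homotopic (s ≫ p) (𝟙 D)) (hs' : Homotopic (p ≫ s) (𝟙 E)) : I.rlp p := by
  rw [homotopic_iff] at hs
  obtain ⟨h, h₀, h₁⟩ := hs
  -- replace `s` by a homotopic strict section `t`
  obtain ⟨S, hS₀, hS⟩ := exists_homotopy_lift_end 0 p s h h₀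
  obtain ⟨t, ht⟩ : ∃ t, t = ι₁ ≫ S := ⟨_, rfl⟩
  have htp : t ≫ p = 𝟙 D := by rw [ht, Category.assoc, hS, h₁]
  have hst : Homotopic s t := (homotopic_iff _ _).2 ⟨S, hS₀, ht.symm⟩
  have hpt : Homotopic (p ≫ t) (𝟙 E) := (hst.precomp p).symm.trans hs'
  rw [homotopic_iff] at hpt
  obtain ⟨k, k₀, k₁⟩ := hpt
  -- `k` goes from `p ≫ t` to the identity, but covers a nonconstant homotopy `k ≫ p` in `D`. The
  -- square `(x, a, b) ↦ p (k (x, max a b))` in `D` is constant on its side `b = 1`. Three sides of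
  -- a lift are `k` on `a = 0`, the constant homotopy on `a = 1`, and on `b = 0` the homotopy
  -- `k ≫ p ≫ t`, which covers `k ≫ p` because `t` is a section; the fourth side is then a
  -- contraction over `D`
  obtain ⟨F, hF₁, hF₂, hF₃, hF₄⟩ := exists_square_lift 0 p (k ≫ p ≫ t) k (fst _ _ ≫ p ≫ t)
    ((α_ _ _ _).hom ≫ E ◁ maxOne ≫ k ≫ p)
    (by
      change ι₀ ≫ k = _
      rw [reassoc_of% k₀, k₀, reassoc_of% htp])
    (by
      rw [reassoc_of% k₁]
      change ι₀ ≫ _ = _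
      rw [ι₀_fst_assoc])
    (by
      have : cylinderEnd 0 (E ⊗ Δ[1]) ≫ (α_ _ _ _).hom ≫ E ◁ maxOne = 𝟙 _ := by
        ext m ⟨x, t⟩
        · rfl
        · exact maxOne_app_const_zero_right x t
      rw [reassoc_of% this]
      simp [htp])
    (by
      have : (ι₀ : E ⟶ _) ▷ Δ[1] ≫ (α_ _ _ _).hom ≫ E ◁ maxOne = 𝟙 _ := by
        ext m ⟨x, s⟩
        · rfl
        · exact maxOne_app_const_zero_left x s
      rw [reassoc_of% this])
    (by
      have : (ι₁ : E ⟶ _) ▷ Δ[1] ≫ (α_ _ _ _).hom ≫ E ◁ maxOne = fst _ _ ≫ ι₁ := by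
        ext m ⟨x, s⟩
        · rfl
        · exact maxOne_app_const_one_left x s
      rw [reassoc_of% this, reassoc_of% k₁]
      simp [htp])
  refine rlp_of_fiberwise_contraction p t htp (ι₁ ≫ F) ?_ ?_ ?_
  · rw [← ι₁_comp_assoc, hF₂, k₁]
  · rw [← ι₁_comp_assoc, hF₃, ι₁_fst_assoc]
  · rw [Category.assoc, hF₄]
    have : ι₁ ≫ (α_ _ _ _).hom ≫ E ◁ maxOne = fst _ _ ≫ ι₁ := by
      ext m ⟨x, s⟩
      · rfl
      · exact maxOne_app_const_one_right x s
    rw [reassoc_of% this, reassoc_of% k₁]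

/-! ### Acyclic monomorphisms lift against Kan fibrations between Kan complexes -/

/-- The exchange of variables `(K ⟶ Z ^ B) → (B ⟶ Z ^ K)`. -/
noncomputable def flipHom {K B Z : SSet.{u}} (g : K ⟶ (ihom B).obj Z) : B ⟶ (ihom K).obj Z :=
  MonoidalClosed.curry ((β_ K B).hom ≫ MonoidalClosed.uncurry g)

@[simp]
lemma flipHom_flipHom {K B Z : SSet.{u}} (g : K ⟶ (ihom B).obj Z) : flipHom (flipHom g) = g := by
  simp [flipHom]

lemma flipHom_pre {K A B Z : SSet.{u}} (j : A ⟶ B) (g : K ⟶ (ihom B).obj Z) :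
    flipHom (g ≫ (MonoidalClosed.pre j).app Z) = j ≫ flipHom g := by
  simp [flipHom, MonoidalClosed.uncurry_pre_app, ← MonoidalClosed.curry_natural_left]

/-- The isomorphism `K × (B × T) ≅ B × (K × T)`. -/
noncomputable def exchange (K B T : SSet.{u}) : K ⊗ (B ⊗ T) ⟶ B ⊗ (K ⊗ T) :=
  CartesianMonoidalCategory.lift (snd _ _ ≫ fst _ _)
    (CartesianMonoidalCategory.lift (fst _ _) (snd _ _ ≫ snd _ _))

/-- The exponential law `[K, Z ^ B] = [B, Z ^ K]`. -/
lemma Homotopic.flip {K B Z : SSet.{u}} {g g' : K ⟶ (ihom B).obj Z} (H : Homotopic g g') :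
    Homotopic (flipHom g) (flipHom g') := by
  rw [homotopic_iff] at H ⊢
  obtain ⟨h, rfl, rfl⟩ := H
  have h₀ : K ◁ ι₀ ≫ exchange K B Δ[1] = (β_ K B).hom ≫ B ◁ ι₀ := rfl
  have h₁ : K ◁ ι₁ ≫ exchange K B Δ[1] = (β_ K B).hom ≫ B ◁ ι₁ := rfl
  refine ⟨MonoidalClosed.curry (exchange K B Δ[1] ≫ MonoidalClosed.uncurry h), ?_, ?_⟩
  · rw [← MonoidalClosed.curry_natural_left, reassoc_of% h₀, ← MonoidalClosed.uncurry_natural_left]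
    rfl
  · rw [← MonoidalClosed.curry_natural_left, reassoc_of% h₁, ← MonoidalClosed.uncurry_natural_left]
    rfl

lemma homotopic_of_flip {K B Z : SSet.{u}} {g g' : K ⟶ (ihom B).obj Z}
    (H : Homotopic (flipHom g) (flipHom g')) : Homotopic g g' := by
  simpa using H.flip

/-- If `j` is an acyclic monomorphism and `Z` a Kan complex, then `Z ^ B ⟶ Z ^ A` has the right
lifting property with respect to boundary inclusions. -/
theorem rlp_pre_of_isWeakEquivalence {A B : SSet.{u}} (j : A ⟶ B) [Mono j]
    (hj : IsWeakEquivalence j) (Z : SSet.{u}) [KanComplex Z] :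
    I.rlp ((MonoidalClosed.pre j).app Z) := by
  have surj {K : SSet.{u}} (g : K ⟶ (ihom A).obj Z) :
      ∃ g' : K ⟶ (ihom B).obj Z, Homotopic (g' ≫ (MonoidalClosed.pre j).app Z) g := by
    obtain ⟨⟨φ⟩, hφ⟩ := (hj ((ihom K).obj Z) inferInstance).2 (Quot.mk _ (flipHom g))
    refine ⟨flipHom φ, homotopic_of_flip ?_⟩
    rw [flipHom_pre, flipHom_flipHom]
    exact homotopic_of_mk_eq hφ
  have inj {K : SSet.{u}} (g g' : K ⟶ (ihom B).obj Z)
      (h : Homotopic (g ≫ (MonoidalClosed.pre j).app Z) (g' ≫ (MonoidalClosed.pre j).app Z)) :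
      Homotopic g g' := by
    refine homotopic_of_flip (homotopic_of_mk_eq
      ((hj ((ihom K).obj Z) inferInstance).1 (Quot.sound ?_)))
    simpa only [flipHom_pre] using h.flip
  obtain ⟨s, hs⟩ := surj (𝟙 _)
  refine rlp_of_homotopyInverse _ s hs (inj _ _ ?_)
  simpa using hs.precomp ((MonoidalClosed.pre j).app Z)

/-- A monomorphism which is a weak equivalence has the left lifting property with respect to
Kan fibrations between Kan complexes. -/
theorem hasLiftingProperty_of_isWeakEquivalence {A B E D : SSet.{u}} (j : A ⟶ B) [Mono j]
    (hj : IsWeakEquivalence j) (q : E ⟶ D) [Fibration q] [KanComplex E] [KanComplex D] :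
    HasLiftingProperty j q := by
  refine ⟨fun {a b} sq => ?_⟩
  -- the vertex of a mapping space given by a map
  let name {A Z : SSet.{u}} (φ : A ⟶ Z) : 𝟙_ SSet.{u} ⟶ (ihom A).obj Z :=
    MonoidalClosed.curry ((ρ_ A).hom ≫ φ)
  have name_pre {Z : SSet.{u}} (φ : B ⟶ Z) :
      name φ ≫ (MonoidalClosed.pre j).app Z = name (j ≫ φ) := by
    apply MonoidalClosed.uncurry_injective
    simp [MonoidalClosed.uncurry_pre_app, name]
  obtain ⟨s, hs⟩ := exists_section_of_rlp (rlp_pre_of_isWeakEquivalence j hj E)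
  -- an extension of `a` to `B`
  obtain ⟨w, hw⟩ : ∃ w : B ⟶ E, name w = name a ≫ s :=
    ⟨(ρ_ B).inv ≫ MonoidalClosed.uncurry (name a ≫ s), by simp [name]⟩
  have hjw : j ≫ w = a := by
    have : name (j ≫ w) = name a := by rw [← name_pre, hw, Category.assoc, hs, Category.comp_id]
    rwa [MonoidalClosed.curry_injective.eq_iff, cancel_epi] at this
  -- the maps `w ≫ q` and `b` agree on `A`, so that they are homotopic relative to `A`
  obtain ⟨F, hF₀, hF₁, hF, -⟩ := exists_homotopy_of_rlp (initial.to (𝟙_ SSet.{u}))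
    (rlp_pre_of_isWeakEquivalence j hj D) (name (w ≫ q)) (name b)
    (by rw [name_pre, name_pre, reassoc_of% hjw, sq.w]) (initialIsInitial.hom_ext _ _)
  obtain ⟨h, hh⟩ : ∃ h : B ⊗ Δ[1] ⟶ D, h = B ◁ (λ_ Δ[1]).inv ≫ MonoidalClosed.uncurry F :=
    ⟨_, rfl⟩
  have hh₀ : ι₀ ≫ h = w ≫ q := by
    have : ι₀ ≫ B ◁ (λ_ Δ[1]).inv = (ρ_ B).inv ≫ B ◁ (ι₀ : 𝟙_ SSet.{u} ⟶ _) := rfl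
    rw [hh, reassoc_of% this, ← MonoidalClosed.uncurry_natural_left, hF₀]
    simp [name]
  have hh₁ : ι₁ ≫ h = b := by
    have : ι₁ ≫ B ◁ (λ_ Δ[1]).inv = (ρ_ B).inv ≫ B ◁ (ι₁ : 𝟙_ SSet.{u} ⟶ _) := rfl
    rw [hh, reassoc_of% this, ← MonoidalClosed.uncurry_natural_left, hF₁]
    simp [name]
  have hjh : j ▷ Δ[1] ≫ h = fst _ _ ≫ a ≫ q := by
    rw [hh, ← whisker_exchange_assoc, ← MonoidalClosed.uncurry_pre_app, hF, name_pre,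
      MonoidalClosed.uncurry_natural_left]
    have : A ◁ (λ_ Δ[1]).inv ≫ A ◁ fst (𝟙_ SSet.{u}) Δ[1] ≫ (ρ_ A).hom = fst _ _ := rfl
    simp only [name, MonoidalClosed.uncurry_curry]
    rw [reassoc_of% this, reassoc_of% hjw]
  obtain ⟨G, hG₀, hG, hGq⟩ := exists_homotopy_lift 0 j q w (fst _ _ ≫ a) h
    (by rw [cylinderEnd_fst_assoc, hjw]) hh₀ (by rw [hjh, Category.assoc])
  exact ⟨⟨⟨ι₁ ≫ G, by rw [← ι₁_comp_assoc, hG, ι₁_fst_assoc], by rw [Category.assoc, hGq, hh₁]⟩⟩⟩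

/-! ### Extension of fibrations along monomorphisms -/

lemma isPullback_iff_forall_app {P X Y Z : SSet.{u}} {t : P ⟶ X} {l : P ⟶ Y} {r : X ⟶ Z}
    {b : Y ⟶ Z} : IsPullback t l r b ↔
      t ≫ r = l ≫ b ∧ ∀ n : SimplexCategoryᵒᵖ,
        (∀ x y : P.obj n, t.app n x = t.app n y → l.app n x = l.app n y → x = y) ∧
        ∀ (x : X.obj n) (y : Y.obj n), r.app n x = b.app n y →
          ∃ z : P.obj n, t.app n z = x ∧ l.app n z = y := by
  constructor
  · intro h
    refine ⟨h.w, fun n => ?_⟩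
    obtain ⟨-, h₁, h₂⟩ := (Types.isPullback_iff _ _ _ _).1 (h.map ((evaluation _ _).obj n))
    exact ⟨fun x y h h' => h₁ x y ⟨h, h'⟩, h₂⟩
  · rintro ⟨w, h⟩
    refine .of_forall_isPullback_app fun n => (Types.isPullback_iff _ _ _ _).2 ⟨?_, ?_, (h n).2⟩
    · ext x
      exact congr_arg (fun φ => φ.app n x) w
    · exact fun x y ⟨h₁, h₂⟩ => (h n).1 x y h₁ h₂

open Classical in
/-- Let `w : X ⟶ M` be the inclusion of a fibrewise strong deformation retract of the restriction
`M` to `A ⊆ B` of a Kan fibration `π : E ⟶ B`. Then `X ⟶ A` extends to a retract `X' ⟶ B` of `π`: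
the simplices of `X'` are those of `E` all of whose faces over `A` belong to `X`. -/
theorem exists_extension_of_deformationRetract {X A B E M : SSet.{u}} {p : X ⟶ A} {i : A ⟶ B}
    [Mono i] {π : E ⟶ B} [Fibration π] {jM : M ⟶ E} {πM : M ⟶ A} (sqM : IsPullback jM πM π i)
    (w : X ⟶ M) [Mono w] (hw : w ≫ πM = p) (ρ : M ⟶ X) (K : M ⊗ Δ[1] ⟶ E)
    (hK₀ : ι₀ ≫ K = jM) (hK₁ : ι₁ ≫ K = ρ ≫ w ≫ jM) (hK : K ≫ π = fst _ _ ≫ jM ≫ π)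
    (hwK : w ▷ Δ[1] ≫ K = fst _ _ ≫ w ≫ jM) :
    ∃ (X' : SSet.{u}) (t : X ⟶ X') (q : X' ⟶ B) (s : X' ⟶ E) (r : E ⟶ X'),
      IsPullback t p q i ∧ s ≫ r = 𝟙 X' ∧ s ≫ π = q ∧ r ≫ q = π := by
  have : Mono jM := (MorphismProperty.monomorphisms SSet.{u}).of_isPullback sqM.flip
    (inferInstanceAs (Mono i))
  have injM {n : SimplexCategoryᵒᵖ} : Function.Injective (jM.app n) :=
    (CategoryTheory.mono_iff_injective _).1 inferInstance
  have injw {n : SimplexCategoryᵒᵖ} : Function.Injective (w.app n) :=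
    (CategoryTheory.mono_iff_injective _).1 inferInstance
  rw [isPullback_iff_forall_app] at sqM
  have memM {n : SimplexCategoryᵒᵖ} (e : E.obj n) (x : M.obj n)
      (h : π.app n e = π.app n (jM.app n x)) : ∃ y, jM.app n y = e := by
    obtain ⟨y, hy, -⟩ := (sqM.2 n).2 e (πM.app n x)
      (h.trans (congr_arg (fun φ => φ.app n x) sqM.1))
    exact ⟨y, hy⟩
  let X' : E.Subcomplex :=
    { obj n := Set.ofPred fun e => ∀ (k : SimplexCategoryᵒᵖ) (θ : n ⟶ k) (x : M.obj k),
        jM.app k x = E.map θ e → ∃ y : X.obj k, w.app k y = x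
      map := by
        intro n m φ e he k θ x hx
        refine he k (φ ≫ θ) x (hx.trans ?_)
        exact (Functor.map_comp_apply E φ θ e).symm }
  have wX' {n : SimplexCategoryᵒᵖ} (y : X.obj n) : jM.app n (w.app n y) ∈ X'.obj n := by
    intro k θ x hx
    refine ⟨X.map θ y, ?_⟩
    apply injM
    rw [hx, NatTrans.naturality_apply w, NatTrans.naturality_apply jM]
  have X'w {n : SimplexCategoryᵒᵖ} (x : M.obj n) (hx : jM.app n x ∈ X'.obj n) :
      ∃ y : X.obj n, w.app n y = x :=
    hx n (𝟙 n) x (Functor.map_id_apply E _ _).symm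
  -- the deformation of `M`, glued with the constant homotopy on `X'`
  let gf (n : SimplexCategoryᵒᵖ) (e : E.obj n) (t : (Δ[1] : SSet.{u}).obj n) : E.obj n :=
    if h : ∃ x, jM.app n x = e then K.app n (h.choose, t) else e
  have gfM {n : SimplexCategoryᵒᵖ} (x : M.obj n) (t : (Δ[1] : SSet.{u}).obj n) :
      gf n (jM.app n x) t = K.app n (x, t) := by
    have h : ∃ y, jM.app n y = jM.app n x := ⟨x, rfl⟩
    have : h.choose = x := injM h.choose_spec
    simp only [gf, dif_pos h, this]
  have gfX {n : SimplexCategoryᵒᵖ} (e : E.obj n) (he : e ∈ X'.obj n)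
      (t : (Δ[1] : SSet.{u}).obj n) : gf n e t = e := by
    by_cases h : ∃ x, jM.app n x = e
    · obtain ⟨x, rfl⟩ := h
      obtain ⟨y, rfl⟩ := X'w x he
      rw [gfM]
      exact congr_arg (fun φ => φ.app n (y, t)) hwK
    · simp only [gf, dif_neg h]
  let S : E.Subcomplex := Subcomplex.range jM ⊔ X'
  let g : (S : SSet.{u}) ⊗ Δ[1] ⟶ E :=
    { app n := ↾fun z => gf n z.1.1 z.2
      naturality := by
        intro n m φ
        ext ⟨⟨e, he⟩, t⟩
        change gf m (E.map φ e) (Δ[1].map φ t) = E.map φ (gf n e t)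
        rcases he with ⟨x, rfl⟩ | he
        · have := NatTrans.naturality_apply K φ (show (M ⊗ Δ[1]).obj n from (x, t))
          rw [gfM, ← this, ← NatTrans.naturality_apply jM, gfM]
          rfl
        · rw [gfX e he, gfX _ (X'.map φ he)] }
  obtain ⟨F, hF₀, hFg, hFπ⟩ := exists_homotopy_lift 0 S.ι π (𝟙 E) g (fst _ _ ≫ π)
    (by
      ext n ⟨e, he⟩
      change gf n e _ = e
      rcases he with ⟨x, rfl⟩ | he
      · rw [gfM]
        exact congr_arg (fun φ => φ.app n x) hK₀
      · exact gfX e he _)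
    (by simp)
    (by
      ext n ⟨⟨e, he⟩, t⟩
      change π.app n e = π.app n (gf n e t)
      rcases he with ⟨x, rfl⟩ | he
      · rw [gfM]
        exact (congr_arg (fun φ => φ.app n (x, t)) hK).symm
      · rw [gfX e he])
  obtain ⟨r, hr⟩ : ∃ r, r = ι₁ ≫ F := ⟨_, rfl⟩
  have hrπ : r ≫ π = π := by rw [hr, Category.assoc, hFπ, ι₁_fst_assoc]
  have hrS : S.ι ≫ r = ι₁ ≫ g := by rw [hr, ← ι₁_comp_assoc, hFg]
  have hrM {n : SimplexCategoryᵒᵖ} (x : M.obj n) :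
      r.app n (jM.app n x) = jM.app n (w.app n (ρ.app n x)) := by
    refine (congr_arg (fun φ => φ.app n ⟨jM.app n x, Or.inl ⟨x, rfl⟩⟩) hrS).trans ?_
    refine (gfM x _).trans ?_
    exact congr_arg (fun φ => φ.app n x) hK₁
  have hrX {n : SimplexCategoryᵒᵖ} (e : E.obj n) (he : e ∈ X'.obj n) : r.app n e = e :=
    (congr_arg (fun φ => φ.app n ⟨e, Or.inr he⟩) hrS).trans (gfX e he _)
  have hr' : Subcomplex.range r ≤ X' := by
    rintro n _ ⟨e, rfl⟩ k θ x hx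
    rw [← NatTrans.naturality_apply r] at hx
    obtain ⟨x', hx'⟩ := memM (E.map θ e) x (by
      rw [hx]
      exact (congr_arg (fun φ => φ.app k (E.map θ e)) hrπ).symm)
    rw [← hx', hrM] at hx
    exact ⟨_, (injM hx).symm⟩
  have ht : Subcomplex.range (w ≫ jM) ≤ X' := by
    rintro n _ ⟨y, rfl⟩
    exact wX' y
  refine ⟨X', Subcomplex.lift (w ≫ jM) ht, X'.ι ≫ π, X'.ι, Subcomplex.lift r hr', ?_, ?_, rfl, ?_⟩
  · rw [isPullback_iff_forall_app]
    refine ⟨?_, fun n => ⟨?_, ?_⟩⟩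
    · change (w ≫ jM) ≫ π = _
      rw [Category.assoc, sqM.1, reassoc_of% hw]
    · intro x y h _
      exact injw (injM (congr_arg Subtype.val h))
    · rintro ⟨e, he⟩ a h
      obtain ⟨x, rfl, rfl⟩ := (sqM.2 n).2 e a h
      obtain ⟨y, rfl⟩ := X'w x he
      exact ⟨y, rfl, (congr_arg (fun φ => φ.app n y) hw).symm⟩
  · ext n ⟨e, he⟩
    exact Subtype.ext (hrX e he)
  · exact hrπ

/-! ### Factorization as a monomorphism followed by a map lifting against boundaries -/

section

attribute [local instance] Cardinal.fact_isRegular_aleph0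
  Cardinal.orderBotAleph0OrdToType

open MorphismProperty in
instance isSmall_I : MorphismProperty.IsSmall.{u} I.{u} :=
  isSmall_ofHoms ..

instance isCardinalForSmallObjectArgument_I :
    MorphismProperty.IsCardinalForSmallObjectArgument I.{u} Cardinal.aleph0.{u} where
  preservesColimit {A B X Y} i hi f hf := by
    have : IsFinitelyPresentable.{u} A := by
      obtain ⟨n⟩ := hi
      infer_instance
    infer_instance

instance hasSmallObjectArgument_I : MorphismProperty.HasSmallObjectArgument.{u} I.{u} :=
  ⟨.aleph0, inferInstance, inferInstance, inferInstance⟩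

end

/-- A map with the left lifting property against `I.rlp` is a retract of a transfinite composition of
pushouts of coproducts of boundary inclusions. -/
lemma mono_of_llp_rlp {X Y : SSet.{u}} {j : X ⟶ Y} (hj : I.rlp.llp j) : Mono j := by
  rw [SmallObject.llp_rlp_of_isCardinalForSmallObjectArgument_aleph0] at hj
  have h₁ : (MorphismProperty.coproducts.{u} I.{u}).pushouts ≤
      MorphismProperty.monomorphisms SSet.{u} := by
    rw [MorphismProperty.pushouts_le_iff, MorphismProperty.coproducts_le_iff]
    exact I_le_monomorphisms
  have h₂ := (MorphismProperty.transfiniteCompositionsOfShape_monotone ℕ h₁).trans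
    (MorphismProperty.transfiniteCompositionsOfShape_le _ _)
  exact (MorphismProperty.retracts_monotone h₂).trans (MorphismProperty.retracts_le _) _ hj

/-- Every map factors as a monomorphism followed by a map with the right lifting property with
respect to boundary inclusions. -/
lemma exists_mono_rlp_factorization {X Y : SSet.{u}} (f : X ⟶ Y) :
    ∃ (W : SSet.{u}) (j : X ⟶ W) (r : W ⟶ Y), Mono j ∧ I.rlp r ∧ j ≫ r = f := by
  let h := MorphismProperty.factorizationData I.{u}.rlp.llp I.{u}.rlp f
  exact ⟨h.Z, h.i, h.p, mono_of_llp_rlp h.hi, h.hp, h.fac⟩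

lemma rlp_of_retract (J : MorphismProperty SSet.{u}) {X' E B : SSet.{u}} {q : X' ⟶ B} {π : E ⟶ B}
    {s : X' ⟶ E} {r : E ⟶ X'} (h₁ : s ≫ r = 𝟙 X') (h₂ : s ≫ π = q) (h₃ : r ≫ q = π)
    (hπ : J.rlp π) : J.rlp q :=
  MorphismProperty.of_retract
    { i := Arrow.homMk s (𝟙 B) (by simpa using h₂)
      r := Arrow.homMk r (𝟙 B) (by simpa using h₃)
      retract := by ext <;> simp [h₁] } hπ

lemma fibration_of_isPullback {X Y X' Y' : SSet.{u}} {g : X' ⟶ X} {f' : X' ⟶ Y'} {f : X ⟶ Y}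
    {c : Y' ⟶ Y} (h : IsPullback g f' f c) [Fibration f] : Fibration f' := by
  rw [modelCategoryQuillen.fibration_iff]
  exact MorphismProperty.of_isPullback h ((modelCategoryQuillen.fibration_iff f).1 inferInstance)

/-! ### Fibrations that extend along a monomorphism -/

/-- The map `p : X ⟶ A` is the restriction to `A` of a Kan fibration over `B`. -/
def Extends {X A B : SSet.{u}} (i : A ⟶ B) (p : X ⟶ A) : Prop :=
  ∃ (X' : SSet.{u}) (t : X ⟶ X') (q : X' ⟶ B), IsPullback t p q i ∧ Fibration q

/-- Maps with the right lifting property with respect to boundary inclusions extend along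
monomorphisms. Indeed, if `p ≫ i = m ≫ π` with `m` a monomorphism and `π` in `I.rlp`, then `p` is a
fibrewise deformation retract of the restriction of `π` to `A`. -/
theorem exists_extension_of_rlp {X A B : SSet.{u}} {p : X ⟶ A} (hp : I.rlp p) (i : A ⟶ B)
    [Mono i] : ∃ (X' : SSet.{u}) (t : X ⟶ X') (q : X' ⟶ B), IsPullback t p q i ∧ I.rlp q := by
  obtain ⟨E, m, π, hm, hπ, fac⟩ := exists_mono_rlp_factorization (p ≫ i)
  have := fibration_of_rlp hπ
  let w : X ⟶ pullback π i := pullback.lift m p fac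
  have hw₁ : w ≫ pullback.fst π i = m := pullback.lift_fst _ _ _
  have hw₂ : w ≫ pullback.snd π i = p := pullback.lift_snd _ _ _
  have : Mono w := by
    have : Mono (w ≫ pullback.fst π i) := by rwa [hw₁]
    exact mono_of_mono w (pullback.fst π i)
  have := hasLiftingProperty_of_rlp w hp
  have sq : CommSq (𝟙 X) w p (pullback.snd π i) := ⟨by simp [hw₂]⟩
  obtain ⟨ρ, hρ₁, hρ₂⟩ : ∃ ρ, w ≫ ρ = 𝟙 X ∧ ρ ≫ p = pullback.snd π i :=
    ⟨sq.lift, sq.fac_left, sq.fac_right⟩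
  obtain ⟨K, hK₀, hK₁, hK, hwK⟩ := exists_homotopy_of_rlp w hπ (pullback.fst π i)
    (ρ ≫ w ≫ pullback.fst π i)
    (by rw [hw₁, Category.assoc, fac, reassoc_of% hρ₂, pullback.condition])
    (by rw [reassoc_of% hρ₁])
  obtain ⟨X', t, q, s, r, h, h₁, h₂, h₃⟩ := exists_extension_of_deformationRetract
    (IsPullback.of_hasPullback π i) w hw₂ ρ K hK₀ hK₁ hK hwK
  exact ⟨X', t, q, h, rlp_of_retract _ h₁ h₂ h₃ hπ⟩

/-- A section of `r` makes `p` a fibrewise deformation retract of `r ≫ p`. -/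
lemma Extends.of_rlp_comp {P X A B : SSet.{u}} {i : A ⟶ B} [Mono i] {p : X ⟶ A} {r : P ⟶ X}
    (hr : I.rlp r) (h : Extends i (r ≫ p)) : Extends i p := by
  obtain ⟨P', t, q, hP, _⟩ := h
  obtain ⟨s, hs⟩ := exists_section_of_rlp hr
  have : Mono s := by
    have : Mono (s ≫ r) := by rw [hs]; infer_instance
    exact mono_of_mono s r
  obtain ⟨K, hK₀, hK₁, hK, hsK⟩ := exists_homotopy_of_rlp s hr (𝟙 P) (r ≫ s)
    (by simp [hs]) (by simp [reassoc_of% hs])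
  obtain ⟨X', t', q', s', r', h, h₁, h₂, h₃⟩ := exists_extension_of_deformationRetract hP s
    (by rw [reassoc_of% hs]) r (K ≫ t) (by rw [reassoc_of% hK₀]) (by rw [reassoc_of% hK₁])
    (by rw [Category.assoc, hP.w, Category.assoc, reassoc_of% hK])
    (by rw [reassoc_of% hsK])
  refine ⟨X', t', q', h, ?_⟩
  rw [modelCategoryQuillen.fibration_iff]
  exact rlp_of_retract _ h₁ h₂ h₃ ((modelCategoryQuillen.fibration_iff q).1 inferInstance)

/-- The map `r` is extended along the inclusion of `V` in the total space of an extension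
of `v`. -/
lemma Extends.rlp_comp {P V A B : SSet.{u}} {i : A ⟶ B} [Mono i] {v : V ⟶ A} {r : P ⟶ V}
    (hr : I.rlp r) (h : Extends i v) : Extends i (r ≫ v) := by
  obtain ⟨V', t, q, hV, _⟩ := h
  have : Mono t := (MorphismProperty.monomorphisms SSet.{u}).of_isPullback hV.flip
    (inferInstanceAs (Mono i))
  obtain ⟨P', t', q', hP, hq'⟩ := exists_extension_of_rlp hr t
  have := fibration_of_rlp hq'
  refine ⟨P', t', q' ≫ q, hP.paste_vert hV, ?_⟩
  rw [HomotopicalAlgebra.fibration_iff]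
  exact MorphismProperty.comp_mem _ _ _ ((HomotopicalAlgebra.fibration_iff _).1 inferInstance)
    ((HomotopicalAlgebra.fibration_iff _).1 inferInstance)

/-- The simplicial set of pairs of a point `a` of `A` and a lift to `X` of the
path `H (a, -)` in `Y`, that is, the pullback of `X ^ Δ[1] ⟶ Y ^ Δ[1] ⟵ A`, described by its
universal property. -/
lemma exists_path_object {X Y A : SSet.{u}} (f : X ⟶ Y) (H : A ⊗ Δ[1] ⟶ Y) :
    ∃ (P : SSet.{u}) (π : P ⟶ A) (Φ : P ⊗ Δ[1] ⟶ X), Φ ≫ f = π ▷ Δ[1] ≫ H ∧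
      (∀ {T : SSet.{u}} (a : T ⟶ A) (φ : T ⊗ Δ[1] ⟶ X), φ ≫ f = a ▷ Δ[1] ≫ H →
        ∃ l : T ⟶ P, l ≫ π = a ∧ l ▷ Δ[1] ≫ Φ = φ) ∧
      ∀ {T : SSet.{u}} (l l' : T ⟶ P), l ≫ π = l' ≫ π → l ▷ Δ[1] ≫ Φ = l' ▷ Δ[1] ≫ Φ → l = l' := by
  let h : A ⟶ (ihom Δ[1]).obj Y := MonoidalClosed.curry ((β_ _ _).hom ≫ H)
  let F := (ihom Δ[1]).map f
  have key {T : SSet.{u}} (l : T ⟶ pullback F h) :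
      l ▷ Δ[1] ≫ (β_ _ _).hom ≫ MonoidalClosed.uncurry (pullback.fst F h) =
        (β_ _ _).hom ≫ MonoidalClosed.uncurry (l ≫ pullback.fst F h) := by
    rw [MonoidalClosed.uncurry_natural_left, BraidedCategory.braiding_naturality_left_assoc]
  refine ⟨pullback F h, pullback.snd _ _, (β_ _ _).hom ≫ MonoidalClosed.uncurry (pullback.fst F h),
    ?_, fun {T} a φ hφ => ?_, fun {T} l l' h₁ h₂ => ?_⟩
  · rw [Category.assoc, ← MonoidalClosed.uncurry_natural_right, pullback.condition,
      MonoidalClosed.uncurry_natural_left, MonoidalClosed.uncurry_curry,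
      ← BraidedCategory.braiding_naturality_left_assoc]
    simp
  · refine ⟨pullback.lift (MonoidalClosed.curry ((β_ _ _).hom ≫ φ)) a ?_, pullback.lift_snd _ _ _,
      ?_⟩
    · apply MonoidalClosed.uncurry_injective
      change MonoidalClosed.uncurry (_ ≫ (ihom Δ[1]).map f) = _
      rw [MonoidalClosed.uncurry_natural_left a, MonoidalClosed.uncurry_natural_right,
        MonoidalClosed.uncurry_curry, MonoidalClosed.uncurry_curry, Category.assoc, hφ,
        ← BraidedCategory.braiding_naturality_right_assoc]
    · rw [key, pullback.lift_fst, MonoidalClosed.uncurry_curry]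
      simp
  · rw [key, key, cancel_epi] at h₂
    exact pullback.hom_ext (MonoidalClosed.uncurry_injective h₂) h₁

/-- The pullbacks of a Kan fibration along two homotopic maps are related by a span of maps having
the right lifting property with respect to boundary inclusions: the evaluations at the two ends of
the lifts to `X` of the paths in `Y` given by the homotopy. -/
theorem exists_rlp_span {X Y A X₀ X₁ : SSet.{u}} {f : X ⟶ Y} [Fibration f] (H : A ⊗ Δ[1] ⟶ Y)
    {g₀ : X₀ ⟶ X} {p₀ : X₀ ⟶ A} (h₀ : IsPullback g₀ p₀ f (ι₀ ≫ H))
    {g₁ : X₁ ⟶ X} {p₁ : X₁ ⟶ A} (h₁ : IsPullback g₁ p₁ f (ι₁ ≫ H)) :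
    ∃ (P : SSet.{u}) (r₀ : P ⟶ X₀) (r₁ : P ⟶ X₁), I.rlp r₀ ∧ I.rlp r₁ ∧ r₀ ≫ p₀ = r₁ ≫ p₁ := by
  obtain ⟨P, π, Φ, hΦ, ex, uniq⟩ := exists_path_object f H
  have key (e : Fin 2) {Z : SSet.{u}} {g : Z ⟶ X} {p : Z ⟶ A}
      (h : IsPullback g p f (cylinderEnd e A ≫ H)) :
      ∃ r : P ⟶ Z, I.rlp r ∧ r ≫ p = π := by
    have w : (cylinderEnd e P ≫ Φ) ≫ f = π ≫ cylinderEnd e A ≫ H := by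
      rw [Category.assoc, hΦ, cylinderEnd_naturality_assoc]
    refine ⟨h.lift (cylinderEnd e P ≫ Φ) π w, ?_, h.lift_snd _ _ _⟩
    rw [← rlp_monomorphisms]
    intro K L k (hk : Mono k)
    -- lifting `k` against the evaluation at `e` amounts to lifting a homotopy along `f`, with a
    -- prescribed end and a prescribed restriction to `K`
    refine ⟨fun {a b} sq => ?_⟩
    have sq₁ : a ≫ cylinderEnd e P ≫ Φ = k ≫ b ≫ g := by
      have := sq.w =≫ g
      rwa [Category.assoc, h.lift_fst, Category.assoc] at this
    have sq₂ : a ≫ π = k ≫ b ≫ p := by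
      have := sq.w =≫ p
      rwa [Category.assoc, h.lift_snd, Category.assoc] at this
    obtain ⟨F, hF₁, hF₂, hF₃⟩ := exists_homotopy_lift e k f (b ≫ g) (a ▷ _ ≫ Φ) ((b ≫ p) ▷ _ ≫ H)
      (by rw [cylinderEnd_naturality_assoc, sq₁])
      (by rw [cylinderEnd_naturality_assoc, Category.assoc, Category.assoc, h.w])
      (by rw [Category.assoc, hΦ, ← comp_whiskerRight_assoc, ← comp_whiskerRight_assoc, sq₂])
    obtain ⟨l, hl₁, hl₂⟩ := ex (b ≫ p) F hF₃
    refine ⟨⟨l, uniq _ _ ?_ ?_, h.hom_ext ?_ ?_⟩⟩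
    · rw [Category.assoc, hl₁, sq₂]
    · rw [comp_whiskerRight_assoc, hl₂, hF₂]
    · rw [Category.assoc, h.lift_fst, ← cylinderEnd_naturality_assoc, hl₂, hF₁]
    · rw [Category.assoc, h.lift_snd, hl₁]
  obtain ⟨r₀, hr₀, hr₀'⟩ := key 0 h₀
  obtain ⟨r₁, hr₁, hr₁'⟩ := key 1 h₁
  exact ⟨P, r₀, r₁, hr₀, hr₁, hr₀'.trans hr₁'.symm⟩

/-- Whether the pullback of a Kan fibration along `c : A ⟶ Y` extends along `i : A ⟶ B` depends only
on the homotopy class of `c`. -/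
lemma extends_iff_of_homotopy {X Y A B : SSet.{u}} (f : X ⟶ Y) [Fibration f] (i : A ⟶ B) [Mono i]
    {c₀ c₁ : A ⟶ Y} (H : Homotopic c₀ c₁) :
    Extends i (pullback.snd f c₀) ↔ Extends i (pullback.snd f c₁) := by
  obtain ⟨h, rfl, rfl⟩ := (homotopic_iff _ _).1 H
  have sq₀ := IsPullback.of_hasPullback f (ι₀ ≫ h)
  have sq₁ := IsPullback.of_hasPullback f (ι₁ ≫ h)
  obtain ⟨P, r₀, r₁, h₀, h₁, hr⟩ := exists_rlp_span h sq₀ sq₁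
  constructor
  · intro h'
    refine .of_rlp_comp h₁ ?_
    rw [← hr]
    exact .rlp_comp h₀ h'
  · intro h'
    refine .of_rlp_comp h₀ ?_
    rw [hr]
    exact .rlp_comp h₁ h'

lemma extends_of_comp {X Y A B : SSet.{u}} (f : X ⟶ Y) [Fibration f] (i : A ⟶ B)
    (b : B ⟶ Y) : Extends i (pullback.snd f (i ≫ b)) := by
  have h := IsPullback.of_hasPullback f b
  have h' := IsPullback.of_hasPullback f (i ≫ b)
  have w : pullback.fst f (i ≫ b) ≫ f = (pullback.snd f (i ≫ b) ≫ i) ≫ b := by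
    rw [h'.w, Category.assoc]
  refine ⟨_, h.lift _ _ w, pullback.snd f b, ?_, ?_⟩
  · refine IsPullback.of_right ?_ (h.lift_snd _ _ w) h
    rwa [h.lift_fst]
  · exact fibration_of_isPullback h

/-! ### Filling the horns in the base of a fibration -/

/-- The homotopy of `Δ[n]` from the identity to `i ↦ max i k`. Both this homotopy and `coneHomotopy`
move each vertex by fixing it or sending it to `k`, so that they preserve the horn `Λ[n, k]`. -/
noncomputable def maxHomotopy {n : ℕ} (k : Fin (n + 1)) : (Δ[n] : SSet.{u}) ⊗ Δ[1] ⟶ Δ[n] where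
  app m := ↾fun z => stdSimplex.objMk
    { toFun i := if stdSimplex.asOrderHom z.2 i = 0 then stdSimplex.asOrderHom z.1 i
        else max (stdSimplex.asOrderHom z.1 i) k
      monotone' i j hij := by
        have h₁ := (stdSimplex.asOrderHom z.1).monotone hij
        have h₂ := (stdSimplex.asOrderHom z.2).monotone hij
        dsimp only
        split_ifs with h h'
        · exact h₁
        · exact h₁.trans (le_max_left _ _)
        · rename_i h'
          rw [h'] at h₂
          exact (h (Fin.le_zero_iff.1 h₂)).elim
        · exact max_le_max h₁ le_rfl }

/-- The homotopy of `Δ[n]` from the constant map `k` to `i ↦ max i k`. -/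
noncomputable def coneHomotopy {n : ℕ} (k : Fin (n + 1)) : (Δ[n] : SSet.{u}) ⊗ Δ[1] ⟶ Δ[n] where
  app m := ↾fun z => stdSimplex.objMk
    { toFun i := if stdSimplex.asOrderHom z.2 i = 0 then k
        else max (stdSimplex.asOrderHom z.1 i) k
      monotone' i j hij := by
        have h₁ := (stdSimplex.asOrderHom z.1).monotone hij
        have h₂ := (stdSimplex.asOrderHom z.2).monotone hij
        dsimp only
        split_ifs with h h'
        · exact le_rfl
        · exact le_max_right _ _
        · rename_i h'
          rw [h'] at h₂
          exact (h (Fin.le_zero_iff.1 h₂)).elim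
        · exact max_le_max h₁ le_rfl }

/-- A homotopy of `Δ[n]` that sends each vertex of a simplex to itself or to `k` preserves the horn
`Λ[n, k]`. -/
lemma app_mem_horn {n : ℕ} {k : Fin (n + 1)} (h : (Δ[n] : SSet.{u}) ⊗ Δ[1] ⟶ Δ[n])
    (hh : ∀ (d : ℕ) (x : Δ[n] _⦋d⦌) (t : Δ[1] _⦋d⦌) (i : Fin (d + 1)),
      (h.app _ (x, t) : Δ[n] _⦋d⦌) i = x i ∨ (h.app _ (x, t) : Δ[n] _⦋d⦌) i = k) :
    Subcomplex.range ((Λ[n, k] : Δ[n].Subcomplex).ι ▷ Δ[1] ≫ h) ≤ Λ[n, k] := by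
  rintro m _ ⟨⟨⟨x, hx⟩, t⟩, rfl⟩
  induction m using Opposite.rec with | _ m
  induction m using SimplexCategory.rec with | _ d
  rw [mem_horn_iff_notMem_range] at hx ⊢
  obtain ⟨j, hj, hx⟩ := hx
  refine ⟨j, hj, ?_⟩
  rintro ⟨i, hi⟩
  rcases hh d x t i with h' | h'
  · exact hx ⟨i, h'.symm.trans hi⟩
  · exact hj (hi.symm.trans h')

/-- The identity of a horn is connected by two homotopies, in opposite directions, to the constant
map at the vertex `k`, which extends to the simplex. -/
theorem exists_horn_contraction {n : ℕ} (k : Fin (n + 2)) :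
    ∃ (m : (Λ[n + 1, k] : SSet.{u}) ⟶ Λ[n + 1, k]) (v : Δ[n + 1] ⟶ (Λ[n + 1, k] : SSet.{u})),
      Homotopic (𝟙 _) m ∧ Homotopic (Λ[n + 1, k].ι ≫ v) m := by
  have hmax := app_mem_horn (k := k) (maxHomotopy.{u} k) (fun d x t i => by
    change (if t i = 0 then x i else max (x i) k) = x i ∨
      (if t i = 0 then x i else max (x i) k) = k
    split_ifs
    · exact Or.inl rfl
    · exact max_choice _ _)
  have hcone := app_mem_horn (k := k) (coneHomotopy.{u} k) (fun d x t i => by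
    change (if t i = 0 then k else max (x i) k) = x i ∨
      (if t i = 0 then k else max (x i) k) = k
    split_ifs
    · exact Or.inr rfl
    · exact max_choice _ _)
  have hk : stdSimplex.obj₀Equiv.symm k ∈ (horn.{u} (n + 1) k).obj _ := by
    rw [mem_horn_iff_notMem_range]
    obtain ⟨j, hj⟩ := exists_ne k
    refine ⟨j, hj, ?_⟩
    rintro ⟨i, hi⟩
    exact hj hi.symm
  refine ⟨ι₁ ≫ Subcomplex.lift _ hmax, const ⟨_, hk⟩,
    (homotopic_iff _ _).2 ⟨Subcomplex.lift _ hmax, ?_, rfl⟩,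
    (homotopic_iff _ _).2 ⟨Subcomplex.lift _ hcone, ?_, ?_⟩⟩
  · ext m ⟨x, hx⟩
    induction m using Opposite.rec with | _ m
    induction m using SimplexCategory.rec with | _ d
    apply Subtype.ext
    exact SSet.stdSimplex.ext _ _ fun i => rfl
  · ext m ⟨x, hx⟩
    induction m using Opposite.rec with | _ m
    induction m using SimplexCategory.rec with | _ d
    apply Subtype.ext
    exact SSet.stdSimplex.ext _ _ fun i => rfl
  · ext m ⟨x, hx⟩
    induction m using Opposite.rec with | _ m
    induction m using SimplexCategory.rec with | _ d
    apply Subtype.ext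
    exact SSet.stdSimplex.ext _ _ fun i => rfl

lemma homotopic_of_sigma {J : Type u} {A : J → SSet.{u}} {Y : SSet.{u}} {a b : ∐ A ⟶ Y}
    (h : ∀ j, Homotopic (Sigma.ι A j ≫ a) (Sigma.ι A j ≫ b)) : Homotopic a b := by
  simp only [homotopic_iff] at h
  choose h h₀ h₁ using h
  let H : ∐ A ⟶ (ihom Δ[1]).obj Y :=
    Sigma.desc fun j => MonoidalClosed.curry ((β_ _ _).hom ≫ h j)
  have hH (j : J) : Sigma.ι A j ▷ Δ[1] ≫ (β_ _ _).hom ≫ MonoidalClosed.uncurry H = h j := by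
    rw [BraidedCategory.braiding_naturality_left_assoc, ← MonoidalClosed.uncurry_natural_left]
    simp [H]
  refine (homotopic_iff _ _).2 ⟨(β_ _ _).hom ≫ MonoidalClosed.uncurry H, ?_, ?_⟩
  · refine Sigma.hom_ext _ _ fun j => ?_
    rw [← ι₀_comp_assoc, hH, h₀]
  · refine Sigma.hom_ext _ _ fun j => ?_
    rw [← ι₁_comp_assoc, hH, h₁]

/-- A map is a Kan fibration if every simplex of the base factors through a map along which the
pullback is a Kan fibration. -/
lemma fibration_of_cover {X Y : SSet.{u}} (f : X ⟶ Y)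
    (h : ∀ (n : ℕ) (v : Δ[n] ⟶ Y), ∃ (Z W : SSet.{u}) (g : Z ⟶ Y) (v' : Δ[n] ⟶ Z) (g' : W ⟶ X)
      (p : W ⟶ Z), v' ≫ g = v ∧ IsPullback g' p f g ∧ Fibration p) : Fibration f := by
  rw [modelCategoryQuillen.fibration_iff]
  intro _ _ _ hi
  simp only [J, MorphismProperty.iSup_iff] at hi
  obtain ⟨n, ⟨k⟩⟩ := hi
  refine ⟨fun {a v} sq => ?_⟩
  obtain ⟨Z, W, g, v', g', p, hv, hp, _⟩ := h _ v
  have sq' : CommSq (hp.lift a (Λ[n + 1, k].ι ≫ v') (by rw [sq.w, Category.assoc, hv]))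
      Λ[n + 1, k].ι p v' := ⟨hp.lift_snd _ _ _⟩
  refine ⟨⟨sq'.lift ≫ g', ?_, ?_⟩⟩
  · rw [sq'.fac_left_assoc, hp.lift_fst]
  · rw [Category.assoc, hp.w, sq'.fac_right_assoc, hv]

/-- Every Kan fibration is the restriction of a Kan fibration over a larger base, in which all
horns of the original base can be filled. -/
theorem exists_horn_filling_step {X Y : SSet.{u}} (f : X ⟶ Y) [Fibration f] :
    ∃ (X₁ Y₁ : SSet.{u}) (f₁ : X₁ ⟶ Y₁) (a : X ⟶ X₁) (b : Y ⟶ Y₁), Fibration f₁ ∧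
      IsPullback a f f₁ b ∧ ∀ (n : ℕ) (k : Fin (n + 2)) (σ : (Λ[n + 1, k] : SSet.{u}) ⟶ Y),
        ∃ τ : Δ[n + 1] ⟶ Y₁, Λ[n + 1, k].ι ≫ τ = σ ≫ b := by
  let J : Type u := Σ (n : ℕ) (k : Fin (n + 2)), ((Λ[n + 1, k] : SSet.{u}) ⟶ Y)
  let A : J → SSet.{u} := fun j => Λ[j.1 + 1, j.2.1]
  let B : J → SSet.{u} := fun j => Δ[j.1 + 1]
  let ι : ∀ j, A j ⟶ B j := fun j => Λ[j.1 + 1, j.2.1].ι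
  let i : ∐ A ⟶ ∐ B := Limits.Sigma.map ι
  let c : ∐ A ⟶ Y := Sigma.desc fun j => j.2.2
  have : ∀ j, Mono (ι j) := fun j => inferInstanceAs (Mono Λ[j.1 + 1, j.2.1].ι)
  have : Mono i := inferInstance
  choose m v hm hv using fun (j : J) => exists_horn_contraction.{u} j.2.1
  have hc₁ : Homotopic c (Sigma.desc fun j => m j ≫ j.2.2) := homotopic_of_sigma fun j => by
    simpa [c] using (hm j).postcomp j.2.2
  have hc₂ : Homotopic (i ≫ Sigma.desc fun j => v j ≫ j.2.2) (Sigma.desc fun j => m j ≫ j.2.2) :=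
    homotopic_of_sigma fun j => by
      simpa [i, ι] using (hv j).postcomp j.2.2
  -- `c` is connected by homotopies to a map which factors through `i`
  obtain ⟨XB, t, q, hq, _⟩ := (extends_iff_of_homotopy f i hc₁).2
    ((extends_iff_of_homotopy f i hc₂).1 (extends_of_comp f i _))
  have hA := IsPullback.of_hasPullback f c
  let s₁ := IsPushout.of_hasPushout c i
  let s₂ := IsPushout.of_hasPushout (pullback.fst f c) t
  have w : pullback.fst f c ≫ f ≫ pushout.inl c i = t ≫ q ≫ pushout.inr c i := by
    rw [hA.w_assoc, s₁.w, hq.w_assoc]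
  let f₁ := s₂.desc (f ≫ pushout.inl c i) (q ≫ pushout.inr c i) w
  -- glue `f` and `q` along their common restriction
  obtain ⟨h₁, h₂⟩ := ((Adhesive.van_kampen' s₁) (pullback.fst f c) t _ _ (pullback.snd f c) f q f₁
    hA hq ⟨s₂.inl_desc _ _ w⟩ ⟨s₂.inr_desc _ _ w⟩ s₂.toCommSq).1 s₂
  refine ⟨_, _, f₁, _, _, fibration_of_cover f₁ fun n v => ?_, h₁, fun n k σ => ?_⟩
  · have hv {Z : SSet.{u}} (g : Z ⟶ pushout c i) (y : Z _⦋n⦌) (hy : g.app _ y = yonedaEquiv v) :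
        yonedaEquiv.symm y ≫ g = v :=
      yonedaEquiv.injective (by rw [yonedaEquiv_comp, Equiv.apply_symm_apply, hy])
    obtain ⟨(_ | _ | _), y, hy⟩ := Types.jointly_surjective_of_isColimit
      ((s₁.map ((evaluation _ _).obj (Opposite.op ⦋n⦌))).isColimit) (yonedaEquiv v)
    · exact ⟨Y, X, _, yonedaEquiv.symm (c.app _ y), _, _, hv _ _ hy, h₁, inferInstance⟩
    · exact ⟨Y, X, _, yonedaEquiv.symm y, _, _, hv _ _ hy, h₁, inferInstance⟩
    · exact ⟨_, _, _, yonedaEquiv.symm y, _, _, hv _ _ hy, h₂, inferInstance⟩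
  · refine ⟨Sigma.ι B ⟨n, k, σ⟩ ≫ pushout.inr c i, ?_⟩
    have : Λ[n + 1, k].ι ≫ Sigma.ι B ⟨n, k, σ⟩ = Sigma.ι A ⟨n, k, σ⟩ ≫ i := by
      simp [i, ι]
    rw [reassoc_of% this, ← s₁.w]
    simp [c]

/-! ### Extension of a fibration to a fibration of Kan complexes -/

/-- If the squares of a sequence of maps are cartesian, so are the squares from each of the maps to
the colimit. -/
lemma isPullback_colimit_ι {F G : ℕ ⥤ SSet.{u}} (α : F ⟶ G)
    (h : ∀ n, IsPullback (F.map (homOfLE (Nat.le_add_right n 1))) (α.app n) (α.app (n + 1))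
      (G.map (homOfLE (Nat.le_add_right n 1)))) (n : ℕ) :
    IsPullback (colimit.ι F n) (α.app n) (colimMap α) (colimit.ι G n) := by
  have h' (m l : ℕ) (φ : m ⟶ l) : IsPullback (F.map φ) (α.app m) (α.app l) (G.map φ) := by
    obtain ⟨d, rfl⟩ := Nat.exists_eq_add_of_le (leOfHom φ)
    obtain rfl : φ = homOfLE (Nat.le_add_right m d) := Subsingleton.elim _ _
    induction d with
    | zero =>
      have : homOfLE (Nat.le_add_right m 0) = 𝟙 m := Subsingleton.elim _ _
      rw [this, F.map_id, G.map_id]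
      exact .of_horiz_isIso ⟨by simp⟩
    | succ d ih =>
      have : homOfLE (Nat.le_add_right m (d + 1)) = homOfLE (Nat.le_add_right m d) ≫
        homOfLE (Nat.le_add_right (m + d) 1) := Subsingleton.elim _ _
      rw [this, F.map_comp, G.map_comp]
      exact ih.paste_horiz (h _)
  rw [isPullback_iff_forall_app]
  refine ⟨by simp, fun k => ?_⟩
  have hF := isColimitOfPreserves ((evaluation _ _).obj k) (colimit.isColimit F)
  have hG := isColimitOfPreserves ((evaluation _ _).obj k) (colimit.isColimit G)
  constructor
  · intro x y hxy hα
    obtain ⟨l, φ, hφ⟩ := (Types.FilteredColimit.isColimit_eq_iff' hF _ _).1 hxy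
    exact ((isPullback_iff_forall_app.1 (h' _ _ φ)).2 k).1 x y hφ hα
  · intro x y hxy
    obtain ⟨m, x, rfl⟩ := Types.jointly_surjective_of_isColimit hF x
    have e : (colimit.ι G m).app k ((α.app m).app k x) = (colimit.ι G n).app k y :=
      (congr_arg (fun φ => φ.app k x) (ι_colimMap α m)).symm.trans hxy
    obtain ⟨l, φ, ψ, hl⟩ := (Types.FilteredColimit.isColimit_eq_iff _ hG).1 e
    obtain ⟨z, hz, hz'⟩ := ((isPullback_iff_forall_app.1 (h' _ _ ψ)).2 k).2
      ((F.map φ).app k x) y ((congr_arg (fun φ => φ.app k x) (α.naturality φ)).trans hl)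
    refine ⟨z, ?_, hz'⟩
    refine (congr_arg (fun φ => φ.app k z) (colimit.w F ψ)).symm.trans ?_
    refine (congr_arg _ hz).trans ?_
    exact congr_arg (fun φ' => φ'.app k x) (colimit.w F φ)

/-- Every Kan fibration is the pullback of a Kan fibration between Kan complexes. -/
theorem exists_isPullback_kanComplex {X Y : SSet.{u}} (f : X ⟶ Y) [Fibration f] :
    ∃ (X' Y' : SSet.{u}) (q : X' ⟶ Y') (a : X ⟶ X') (b : Y ⟶ Y'), Fibration q ∧
      KanComplex X' ∧ KanComplex Y' ∧ IsPullback a f q b := by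
  have step (p : {p : Arrow SSet.{u} // Fibration p.hom}) :
      ∃ (p' : {p : Arrow SSet.{u} // Fibration p.hom}) (φ : p.1 ⟶ p'.1),
        IsPullback φ.left p.1.hom p'.1.hom φ.right ∧
        ∀ (n : ℕ) (k : Fin (n + 2)) (σ : (Λ[n + 1, k] : SSet.{u}) ⟶ p.1.right),
          ∃ τ : Δ[n + 1] ⟶ p'.1.right, Λ[n + 1, k].ι ≫ τ = σ ≫ φ.right := by
    have := p.2
    obtain ⟨X₁, Y₁, f₁, a, b, h₁, h₂, h₃⟩ := exists_horn_filling_step p.1.hom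
    exact ⟨⟨Arrow.mk f₁, h₁⟩, Arrow.homMk a b h₂.w, h₂, h₃⟩
  choose next φ hφ fill using step
  let stage (n : ℕ) : {p : Arrow SSet.{u} // Fibration p.hom} :=
    n.rec ⟨Arrow.mk f, ‹_›⟩ fun _ => next
  let T : ℕ ⥤ Arrow SSet.{u} :=
    Functor.ofSequence (X := fun n => (stage n).1) fun n => φ (stage n)
  have hT (n : ℕ) : T.map (homOfLE (Nat.le_add_right n 1)) = φ (stage n) :=
    Functor.ofSequence_map_homOfLE_succ _ n
  let F : ℕ ⥤ SSet.{u} := T ⋙ Arrow.leftFunc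
  let G : ℕ ⥤ SSet.{u} := T ⋙ Arrow.rightFunc
  let α : F ⟶ G := Functor.whiskerLeft T Arrow.leftToRight
  have pb := isPullback_colimit_ι α fun n => by
    have := hφ (stage n)
    rw [← hT] at this
    exact this
  -- a finitely presentable simplicial set, such as a horn or a simplex, maps to a finite stage
  have factor {K : SSet.{u}} [IsFinitelyPresentable.{u} K] (g : K ⟶ colimit G) :
      ∃ (n : ℕ) (g' : K ⟶ G.obj n), g' ≫ colimit.ι G n = g := by
    have := Cardinal.fact_isRegular_aleph0.{u}
    have : IsCardinalFiltered ℕ Cardinal.aleph0.{u} :=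
      (isCardinalFiltered_aleph0_iff ℕ).2 inferInstance
    have := preservesColimitsOfShape_of_isCardinalPresentable_of_essentiallySmall K
      Cardinal.aleph0.{u} ℕ
    exact exists_hom_of_preservesColimit_coyoneda (colimit.isColimit G) g
  have hq : Fibration (colimMap α) := fibration_of_cover _ fun n v => by
    obtain ⟨m, v', hv'⟩ := factor v
    exact ⟨_, _, _, v', _, _, hv', pb m, (stage m).2⟩
  have hY : KanComplex (colimit G) := by
    rw [KanComplex, isFibrant_iff, modelCategoryQuillen.fibration_iff]
    intro _ _ _ hi
    simp only [J, MorphismProperty.iSup_iff] at hi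
    obtain ⟨n, ⟨k⟩⟩ := hi
    refine ⟨fun {σ _} sq => ?_⟩
    obtain ⟨m, σ', rfl⟩ := factor σ
    obtain ⟨τ, hτ⟩ := fill (stage m) n k σ'
    refine ⟨⟨τ ≫ colimit.ι G (m + 1), ?_, Subsingleton.elim _ _⟩⟩
    have w : (φ (stage m)).right ≫ colimit.ι G (m + 1) = colimit.ι G m :=
      (congr_arg (fun ψ => ψ.right ≫ colimit.ι G (m + 1)) (hT m)).symm.trans (colimit.w G _)
    exact (reassoc_of% hτ) _ |>.trans (congr_arg (σ' ≫ ·) w)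
  exact ⟨_, _, colimMap α, _, _, hq, isFibrant_of_fibration (colimMap α), hY, pb 0⟩

/-! ### Acyclic fibrations -/

/-- A Kan fibration that is a weak equivalence is a retract of the second map of its factorization as
a monomorphism followed by a map in `I.rlp`. -/
theorem rlp_of_fibration_of_isWeakEquivalence {X Y : SSet.{u}} (f : X ⟶ Y) [Fibration f]
    (hf : IsWeakEquivalence f) : I.rlp f := by
  obtain ⟨W, j, r, _, hr, rfl⟩ := exists_mono_rlp_factorization f
  have hj : IsWeakEquivalence j := .of_comp (isWeakEquivalence_of_rlp hr) hf
  obtain ⟨X', Y', q, a, b, _, _, _, h⟩ := exists_isPullback_kanComplex (j ≫ r)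
  have := hasLiftingProperty_of_isWeakEquivalence j hj q
  have sq : CommSq a j q (r ≫ b) := ⟨by simpa using h.w⟩
  refine rlp_of_retract I (s := j) (r := h.lift sq.lift r sq.fac_right) ?_ rfl
    (h.lift_snd _ _ _) hr
  apply h.hom_ext <;> simp

end SimplicialHomotopy

theorem lemma2p4 {X Y : SSet.{u}} (f : X ⟶ Y) :
    SimplicialHomotopy.IsAcyclicFibration f ↔
      ∀ n : ℕ, HasLiftingProperty (SSet.boundary.{u} n).ι f := by
  constructor
  · rintro ⟨_, hf⟩ n
    exact SimplicialHomotopy.rlp_of_fibration_of_isWeakEquivalence f hf _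
      (SSet.modelCategoryQuillen.boundary_ι_mem_I n)
  · intro h
    have hf : SSet.modelCategoryQuillen.I.rlp f := by
      rintro _ _ _ ⟨n⟩
      exact h n
    exact ⟨SimplicialHomotopy.fibration_of_rlp hf, SimplicialHomotopy.isWeakEquivalence_of_rlp hf⟩
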